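/- **Setting.** Let $X_1,X_2,\dots$ be i.i.d. random variables with values in a finite alphabet $\mathcal X$, and let $H(X)$ be the Shannon entropy (base 2) of their common law. A *regular cumulative function* is a non-decreasing $F:[0,1]\to[0,\infty)$ with $F(0)=0$ that is right-continuous on $[0,1)$. Let $G$ (the cumulative rate distribution function) and $L$ (the cumulative leakage function) be regular cumulative functions. For $k,n\ge 1$ and $\varepsilon\ge 0$, a $(G,k,n)$-*source code with rate excess* $\varepsilon$ consists of encoders $\varphi_i:\mathcal X^{in}\to\mathcal M_i=\{1,\dots,2^{\lfloor nk(R_i+\varepsilon)\rfloor}\}$, $R_i=G(i/k)-G((i-1)/k)$, $i=1,\dots,k$, and a decoder $\psi:\mathcal M_1\times\dots\times\mathcal M_k\to\mathcal X^{nk}$; put $M_i=\varphi_i(X^{in})$, $M^i=(M_1,\dots,M_i)$ and $\hat X^{nk}=\psi(M^k)$. $G$ is *achievable* for lossless sequential coding under $L$ if for every $k\ge1$ there are $\varepsilon_n\ge0$ with $\varepsilon_n\to0$ and $(G,k,n)$-source codes with rate excess $\varepsilon_n$, $n\ge 1$, such that $$\lim_{n\to\infty}\Pr\{X^{nk}\ne\hat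 X^{nk}\}=0,\qquad \frac1{nk}I(X^{in};M^i)\le L(i/k)\quad\text{for all } n\ge1 \text{ and } i\in\{1,\dots,k\}.$$ $G$ is *exactly achievable* under $L$ if for every $k$ this is possible with $\varepsilon_n=0$ for all $n$. **Theorem.** $G$ is achievable under $L$ if and only if $$G(1)-G(\alpha)\ \ge\ \max\{(1-\alpha)H(X),\ H(X)-L(\alpha)\}\qquad\text{for all }\alpha\in[0,1].\tag{1}$$ Moreover, if $G$ is exactly achievable under $L$, then (1) holds; and if the inequality in (1) is strict for all $\alpha\in[0,1)$ and $L(1)\ge H(X)$, then $G$ is exactly achievable under $L$. -/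

import Mathlib

open MeasureTheory ProbabilityTheory Filter Topology

noncomputable section

namespace SeqCoding

/-- A regular cumulative function on `[0,1]`: non-decreasing, zero at `0`, right-continuous on
`[0,1)`. Only the values on `[0,1]` matter; there `F` is nonnegative by the first two fields. -/
structure IsRegularCumulative (F : ℝ → ℝ) : Prop where
  monotoneOn : MonotoneOn F (Set.Icc 0 1)
  zero : F 0 = 0
  right_continuous : ∀ α ∈ Set.Ico (0 : ℝ) 1, Tendsto F (𝓝[>] α) (𝓝 (F α))

section Information

variable {Ω A B : Type*} [MeasurableSpace Ω]

/-- Shannon entropy, in bits, of a random variable `Y` with values in a finite set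
(with `0 * log 0 = 0`). -/
def entropy [Fintype A] (μ : Measure Ω) (Y : Ω → A) : ℝ :=
  -∑ a, μ.real {ω | Y ω = a} * Real.logb 2 (μ.real {ω | Y ω = a})

/-- Mutual information, in bits, of two random variables with values in finite sets
(terms with joint probability zero vanish). -/
def mutualInfo [Fintype A] [Fintype B] (μ : Measure Ω) (Y : Ω → A) (Z : Ω → B) : ℝ :=
  ∑ a, ∑ b, μ.real {ω | Y ω = a ∧ Z ω = b} *
    Real.logb 2 (μ.real {ω | Y ω = a ∧ Z ω = b} /
      (μ.real {ω | Y ω = a} * μ.real {ω | Z ω = b}))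

end Information

/-- The rate `R = G(i/k) - G((i-1)/k)` of the `i`-th sub-block; sub-blocks are numbered from `0`
here, so `i : Fin k` stands for the sub-block `i + 1`. -/
def rate (G : ℝ → ℝ) (k : ℕ) (i : Fin k) : ℝ :=
  G (((i : ℝ) + 1) / k) - G ((i : ℝ) / k)

/-- The number `2 ^ ⌊n k (R + ε)⌋` of messages available to the `i`-th encoder at rate excess `ε`
(`ε = 0`: no excess). -/
def numMessages (G : ℝ → ℝ) (ε : ℝ) (k n : ℕ) (i : Fin k) : ℕ :=
  2 ^ ⌊(n : ℝ) * k * (rate G k i + ε)⌋₊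

/-- A `(G, k, n)`-source code with rate excess `ε`: the `i`-th encoder sees all symbols
of the sub-blocks up to and including the `i`-th one, the decoder sees all `k` messages. -/
structure SourceCode (𝒳 : Type*) (G : ℝ → ℝ) (ε : ℝ) (k n : ℕ) where
  enc : (i : Fin k) → (Fin (((i : ℕ) + 1) * n) → 𝒳) → Fin (numMessages G ε k n i)
  dec : ((i : Fin k) → Fin (numMessages G ε k n i)) → (Fin (k * n) → 𝒳)

section Achievability

variable {Ω 𝒳 : Type*}

/-- The first `m` symbols of the source sequence. -/
def sourcePrefix (X : ℕ → Ω → 𝒳) (m : ℕ) (ω : Ω) : Fin m → 𝒳 :=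
  fun j => X j ω

/-- The message produced by the `i`-th encoder. -/
def SourceCode.message {G : ℝ → ℝ} {ε : ℝ} {k n : ℕ} (c : SourceCode 𝒳 G ε k n)
    (X : ℕ → Ω → 𝒳) (i : Fin k) (ω : Ω) : Fin (numMessages G ε k n i) :=
  c.enc i (sourcePrefix X (((i : ℕ) + 1) * n) ω)

/-- The messages of all sub-blocks up to and including the `i`-th one. -/
def SourceCode.messagesUpTo {G : ℝ → ℝ} {ε : ℝ} {k n : ℕ} (c : SourceCode 𝒳 G ε k n)
    (X : ℕ → Ω → 𝒳) (i : Fin k) (ω : Ω) :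
    (j : {j : Fin k // j ≤ i}) → Fin (numMessages G ε k n j) :=
  fun j => c.message X j ω

/-- The reconstruction of the whole block of `k * n` symbols. -/
def SourceCode.reconstruction {G : ℝ → ℝ} {ε : ℝ} {k n : ℕ} (c : SourceCode 𝒳 G ε k n)
    (X : ℕ → Ω → 𝒳) (ω : Ω) : Fin (k * n) → 𝒳 :=
  c.dec (fun i => c.message X i ω)

/-- A sequence of codes, `c n` for block length `n` and `k` sub-blocks, is lossless (vanishing
error probability) and respects the leakage constraint `L` at the end of every sub-block. -/
def LosslessAndSecure [MeasurableSpace Ω] [Fintype 𝒳] (μ : Measure Ω) (X : ℕ → Ω → 𝒳)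
    (G L : ℝ → ℝ) (k : ℕ) (ε : ℕ → ℝ) (c : (n : ℕ) → SourceCode 𝒳 G (ε n) k n) : Prop :=
  Tendsto (fun n => μ.real {ω | sourcePrefix X (k * n) ω ≠ (c n).reconstruction X ω})
      atTop (𝓝 0) ∧
    ∀ n : ℕ, 1 ≤ n → ∀ i : Fin k,
      1 / ((n : ℝ) * k) *
          mutualInfo μ (sourcePrefix X (((i : ℕ) + 1) * n)) ((c n).messagesUpTo X i)
        ≤ L (((i : ℝ) + 1) / k)

/-- `G` is exactly achievable given `L`: for every number `k` of sub-blocks there are suitable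
codes whose message sets have exactly `2 ^ ⌊n k R⌋` elements. -/
def ExactlyAchievable [MeasurableSpace Ω] [Fintype 𝒳] (μ : Measure Ω) (X : ℕ → Ω → 𝒳)
    (G L : ℝ → ℝ) : Prop :=
  ∀ k : ℕ, 1 ≤ k → ∃ c : (n : ℕ) → SourceCode 𝒳 G 0 k n,
    LosslessAndSecure μ X G L k (fun _ => 0) c

/-- `G` is achievable given `L`: for every number `k` of sub-blocks there are suitable codes whose
rates exceed those prescribed by `G` by at most a vanishing amount as `n → ∞`. -/
def Achievable [MeasurableSpace Ω] [Fintype 𝒳] (μ : Measure Ω) (X : ℕ → Ω → 𝒳)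
    (G L : ℝ → ℝ) : Prop :=
  ∀ k : ℕ, 1 ≤ k → ∃ ε : ℕ → ℝ, (∀ n, 0 ≤ ε n) ∧ Tendsto ε atTop (𝓝 0) ∧
    ∃ c : (n : ℕ) → SourceCode 𝒳 G (ε n) k n, LosslessAndSecure μ X G L k ε c

end Achievability

end SeqCoding

end

/-! Converse. Encoders are deterministic, so the leakage `I(X^{in}; M^i)` equals `H(M^i)`
(`mutualInfo_comp`). By Fano, `nk H(X) ≤ H(M^k) + o(n)`. If `V` determines `M^i`, then `H(M^k)` is
at most `H(V)` plus the number of bits in the later messages, about `nk (G(1) - G(i/k))`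
(`entropy_source_le_of_determines`). Taking `V = X^{in}` gives the rate bound and `V = M^i` the
leakage bound, both at `α = i/k`. Every rational point of `(0,1]` is such a grid point, and
right-continuity covers the rest.

Direct part. Compress each block of `n` letters to `m ≈ n (H(X) + δ)` bits by a typical set, and
send the resulting `km` bits as late as the later capacities permit. Then `max (0, km - (bits
available from message i on))` bits precede message `i`. The bound `(1 - α) H(X)` makes this
schedule causal: no bit is due before its block has been seen. The bound `H(X) - L(α)` makes the
number of bits sent so far, hence their entropy, fit the leakage budget. After the last sub-block
the leakage is at most `nk H(X) ≤ nk L(1)`. Compression and rounding cost a slack of `δ + 2/n` per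
letter (`exists_code_of_slack`), paid by the rate excess or by strictness in (1). -/

noncomputable section

namespace SeqCoding

/-! ### Entropy inequalities on finite alphabets -/

section FiniteEntropy

variable {Ω A B C : Type*} [MeasurableSpace Ω] {μ : Measure Ω}

/-- All events described by `Y` are measurable. -/
def DiscretelyMeasurable (Y : Ω → A) : Prop :=
  ∀ s : Set A, MeasurableSet (Y ⁻¹' s)

lemma DiscretelyMeasurable.comp {Y : Ω → A} (hY : DiscretelyMeasurable Y) (f : A → B) :
    DiscretelyMeasurable (fun ω => f (Y ω)) :=
  fun s => hY (f ⁻¹' s)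

/-- The probability mass function of `Y`. -/
def law (μ : Measure Ω) (Y : Ω → A) (a : A) : ℝ :=
  μ.real {ω | Y ω = a}

lemma law_nonneg (Y : Ω → A) (a : A) : 0 ≤ law μ Y a :=
  measureReal_nonneg

lemma entropy_eq_sum_law [Fintype A] (Y : Ω → A) :
    entropy μ Y = -∑ a, law μ Y a * Real.logb 2 (law μ Y a) :=
  rfl

/-- This is `log x ≤ x - 1` at `x = q / p`; summing over the alphabet gives Gibbs' inequality. -/
lemma mul_logb_sub_le {p q : ℝ} (hp : 0 ≤ p) (hq : 0 ≤ q) (h : q = 0 → p = 0) :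
    p * Real.logb 2 q - p * Real.logb 2 p ≤ (q - p) / Real.log 2 := by
  have h2 : 0 < Real.log 2 := Real.log_pos one_lt_two
  rcases hp.eq_or_lt with rfl | hp'
  · simpa using div_nonneg hq h2.le
  have hq' : 0 < q := hq.lt_of_ne fun h0 => hp'.ne' (h h0.symm)
  rw [← mul_sub, ← Real.logb_div hq'.ne' hp'.ne', Real.logb, ← mul_div_assoc]
  gcongr
  calc p * Real.log (q / p) ≤ p * (q / p - 1) := by
        gcongr; exact Real.log_le_sub_one_of_pos (by positivity)
    _ = q - p := by field_simp

variable [IsProbabilityMeasure μ]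

lemma law_le_law_comp (Y : Ω → A) (f : A → B) (a : A) :
    law μ Y a ≤ law μ (fun ω => f (Y ω)) (f a) :=
  measureReal_mono (fun ω (h : Y ω = a) => by simp [h])

lemma sum_law_mul_eq_integral [Fintype A] {Y : Ω → A} (hY : DiscretelyMeasurable Y)
    (φ : A → ℝ) : ∑ a, law μ Y a * φ a = ∫ ω, φ (Y ω) ∂μ := by
  classical
  have h : ∀ ω, φ (Y ω) = ∑ a, (Y ⁻¹' {a}).indicator (fun _ => φ a) ω := fun ω => by
    simp [Set.indicator_apply, Finset.sum_ite_eq]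
  simp_rw [h]
  rw [integral_finsetSum]
  · refine Finset.sum_congr rfl fun a _ => ?_
    rw [integral_indicator_const _ (hY _)]
    rfl
  · exact fun a _ => (integrable_const _).indicator (hY _)

lemma sum_law_comp_mul [Fintype A] [Fintype B] {Y : Ω → A} (hY : DiscretelyMeasurable Y)
    (f : A → B) (φ : B → ℝ) :
    ∑ b, law μ (fun ω => f (Y ω)) b * φ b = ∑ a, law μ Y a * φ (f a) := by
  rw [sum_law_mul_eq_integral (hY.comp f), sum_law_mul_eq_integral hY]

lemma sum_law [Fintype A] {Y : Ω → A} (hY : DiscretelyMeasurable Y) : ∑ a, law μ Y a = 1 := by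
  simpa using sum_law_mul_eq_integral (μ := μ) hY (fun _ => 1)

/-- Writing entropies of functions of `Y` as sums against the law of `Y` lets them be compared term
by term. -/
lemma entropy_comp_eq [Fintype A] [Fintype B] {Y : Ω → A} (hY : DiscretelyMeasurable Y)
    (f : A → B) :
    entropy μ (fun ω => f (Y ω))
      = -∑ a, law μ Y a * Real.logb 2 (law μ (fun ω => f (Y ω)) (f a)) := by
  rw [entropy_eq_sum_law, sum_law_comp_mul hY f]

/-- Gibbs' inequality. -/
lemma entropy_le_cross_entropy [Fintype A] {Y : Ω → A} (hY : DiscretelyMeasurable Y)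
    {q : A → ℝ} (hq : ∀ a, 0 ≤ q a) (hq1 : ∑ a, q a ≤ 1) (h0 : ∀ a, q a = 0 → law μ Y a = 0) :
    entropy μ Y ≤ -∑ a, law μ Y a * Real.logb 2 (q a) := by
  have h := Finset.sum_le_sum fun a (_ : a ∈ Finset.univ) =>
    mul_logb_sub_le (law_nonneg (μ := μ) Y a) (hq a) (h0 a)
  rw [Finset.sum_sub_distrib, ← Finset.sum_div, Finset.sum_sub_distrib, sum_law hY] at h
  have h3 : (∑ a, q a - 1) / Real.log 2 ≤ 0 :=
    div_nonpos_of_nonpos_of_nonneg (by linarith) (Real.log_pos one_lt_two).le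
  rw [entropy_eq_sum_law]
  linarith

lemma entropy_comp_le [Fintype A] [Fintype B] {Y : Ω → A} (hY : DiscretelyMeasurable Y)
    (f : A → B) : entropy μ (fun ω => f (Y ω)) ≤ entropy μ Y := by
  rw [entropy_comp_eq hY, entropy_eq_sum_law]
  refine neg_le_neg (Finset.sum_le_sum fun a _ => ?_)
  rcases (law_nonneg (μ := μ) Y a).eq_or_lt with h | h
  · simp [← h]
  · gcongr
    · exact one_lt_two
    · exact law_le_law_comp Y f a

/-- Gibbs' inequality against the product of the marginals. -/
lemma entropy_prod_le [Fintype A] [Fintype B] [Fintype C] {Y : Ω → C}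
    (hY : DiscretelyMeasurable Y) (f : C → A) (g : C → B) :
    entropy μ (fun ω => (f (Y ω), g (Y ω)))
      ≤ entropy μ (fun ω => f (Y ω)) + entropy μ (fun ω => g (Y ω)) := by
  set p := law μ (fun ω => f (Y ω))
  set r := law μ (fun ω => g (Y ω))
  have hY' : DiscretelyMeasurable (fun ω => (f (Y ω), g (Y ω))) := hY.comp fun c => (f c, g c)
  have hp : ∀ c, law μ (fun ω => (f (Y ω), g (Y ω))) c ≤ p c.1 :=
    fun c => law_le_law_comp (fun ω => (f (Y ω), g (Y ω))) Prod.fst c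
  have hr : ∀ c, law μ (fun ω => (f (Y ω), g (Y ω))) c ≤ r c.2 :=
    fun c => law_le_law_comp (fun ω => (f (Y ω), g (Y ω))) Prod.snd c
  refine (entropy_le_cross_entropy hY' (q := fun c => p c.1 * r c.2)
    (fun c => mul_nonneg (law_nonneg _ _) (law_nonneg _ _)) ?_ ?_).trans_eq ?_
  · rw [Fintype.sum_prod_type]
    simp_rw [← Finset.mul_sum]
    rw [sum_law (hY.comp g), ← Finset.sum_mul, sum_law (hY.comp f), one_mul]
  · intro c hc
    refine le_antisymm ?_ (law_nonneg _ _)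
    rcases mul_eq_zero.1 hc with h | h
    · exact h ▸ hp c
    · exact h ▸ hr c
  · rw [sum_law_comp_mul hY (fun c => (f c, g c)), entropy_comp_eq hY f, entropy_comp_eq hY g,
      ← neg_add, ← Finset.sum_add_distrib]
    congr 1
    refine Finset.sum_congr rfl fun c _ => ?_
    rcases (law_nonneg (μ := μ) Y c).eq_or_lt with h | h
    · simp [← h]
    · have h1 : 0 < p (f c) := h.trans_le (law_le_law_comp Y f c)
      have h2 : 0 < r (g c) := h.trans_le (law_le_law_comp Y g c)
      rw [Real.logb_mul h1.ne' h2.ne', mul_add]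

lemma entropy_le_logb_card [Fintype A] {Y : Ω → A} (hY : DiscretelyMeasurable Y) :
    entropy μ Y ≤ Real.logb 2 (Fintype.card A) := by
  obtain ⟨ω⟩ : Nonempty Ω := nonempty_of_isProbabilityMeasure μ
  have : Nonempty A := ⟨Y ω⟩
  have hc : (Fintype.card A : ℝ) ≠ 0 := by simp
  refine (entropy_le_cross_entropy hY (q := fun _ => (Fintype.card A : ℝ)⁻¹)
    (fun _ => by positivity) ?_ ?_).trans_eq ?_
  · simp
  · simp
  · rw [← Finset.sum_mul, sum_law hY, Real.logb_inv, one_mul, neg_neg]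

/-- The joint law lives on the graph of `f`, where the joint probability cancels against that of
`Y`. -/
lemma mutualInfo_comp [Fintype A] [Fintype B] {Y : Ω → A} (hY : DiscretelyMeasurable Y)
    (f : A → B) : mutualInfo μ Y (fun ω => f (Y ω)) = entropy μ (fun ω => f (Y ω)) := by
  classical
  rw [entropy_comp_eq hY, mutualInfo, ← Finset.sum_neg_distrib]
  refine Finset.sum_congr rfl fun a _ => ?_
  rw [Finset.sum_eq_single (f a)]
  · have h : {ω | Y ω = a ∧ f (Y ω) = f a} = {ω | Y ω = a} := by
      ext ω; simp only [Set.mem_ofPred_eq, and_iff_left_iff_imp]; rintro rfl; rfl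
    rw [h]
    change law μ Y a * Real.logb 2 (law μ Y a / (law μ Y a * law μ (fun ω => f (Y ω)) (f a))) = _
    rcases eq_or_ne (law μ Y a) 0 with h0 | h0
    · simp [h0]
    · rw [div_mul_cancel_left₀ h0, Real.logb_inv, mul_neg]
  · intro b _ hb
    have h : {ω | Y ω = a ∧ f (Y ω) = b} = ∅ := by
      ext ω; simp only [Set.mem_ofPred_eq, Set.mem_empty_iff_false, iff_false, not_and]
      rintro rfl; exact hb.symm
    simp [h]
  · simp

/-- Fano's inequality: `f (Y)` determines `Y` up to an event of probability `p`. -/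
lemma entropy_le_of_decoder [Fintype A] [Fintype B] {Y : Ω → A} (hY : DiscretelyMeasurable Y)
    (f : A → B) (d : B → A) :
    entropy μ Y ≤ entropy μ (fun ω => f (Y ω))
      + (1 + μ.real {ω | Y ω ≠ d (f (Y ω))} * Real.logb 2 (Fintype.card A)) := by
  classical
  obtain ⟨ω₀⟩ : Nonempty Ω := nonempty_of_isProbabilityMeasure μ
  have : Nonempty A := ⟨Y ω₀⟩
  -- `w` reveals `Y` exactly when decoding fails, so `(f (Y), w (Y))` determines `Y`.
  let w : A → Option A := fun a => if a = d (f a) then none else some a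
  have h1 : entropy μ Y ≤ entropy μ (fun ω => (f (Y ω), w (Y ω))) := by
    have h := entropy_comp_le (μ := μ) (hY.comp fun a => (f a, w a))
      (fun c => c.2.elim (d c.1) id)
    have h' : (fun ω => (w (Y ω)).elim (d (f (Y ω))) id) = Y := by
      funext ω
      by_cases hω : Y ω = d (f (Y ω))
      · simp only [w, if_pos hω]; exact hω.symm
      · simp only [w, if_neg hω]; rfl
    simpa only [h'] using h
  refine h1.trans ((entropy_prod_le hY f w).trans (add_le_add le_rfl ?_))
  have hc : (0 : ℝ) < Fintype.card A := by exact_mod_cast Fintype.card_pos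
  -- Mass `1/2` on "no error" and `1/2` spread uniformly over `A`: the cross entropy is exactly the
  -- Fano term.
  refine (entropy_le_cross_entropy (hY.comp w)
    (q := fun o => o.elim (1 / 2) fun _ => (2 * (Fintype.card A : ℝ))⁻¹) ?_ ?_ ?_).trans_eq ?_
  · rintro (_ | _) <;> simp
  · rw [Fintype.sum_option]
    simp
    field_simp
    norm_num
  · rintro (_ | _) <;> simp
  · rw [sum_law_comp_mul hY w]
    have h2 : ∀ a, Real.logb 2 ((w a).elim (1 / 2) fun _ => (2 * (Fintype.card A : ℝ))⁻¹)
        = -1 - {a | a ≠ d (f a)}.indicator 1 a * Real.logb 2 (Fintype.card A) := by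
      intro a
      by_cases ha : a = d (f a)
      · have : a ∉ {a | a ≠ d (f a)} := fun h => h ha
        simp only [w, if_pos ha, Set.indicator_of_notMem this]
        simp [Real.logb_inv]
      · have : a ∈ {a | a ≠ d (f a)} := ha
        simp only [w, if_neg ha, Set.indicator_of_mem this]
        simp only [Option.elim, Real.logb_inv, Real.logb_mul two_ne_zero hc.ne', Pi.one_apply,
          Real.logb_self_eq_one one_lt_two]
        ring
    simp_rw [h2, mul_sub, ← mul_assoc]
    rw [Finset.sum_sub_distrib, ← Finset.sum_mul, ← Finset.sum_mul, sum_law hY,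
      sum_law_mul_eq_integral hY]
    have h3 : ∫ ω, {a | a ≠ d (f a)}.indicator (1 : A → ℝ) (Y ω) ∂μ
        = μ.real {ω | Y ω ≠ d (f (Y ω))} :=
      integral_indicator_one (hY {a | a ≠ d (f a)})
    rw [h3]
    ring

end FiniteEntropy

/-! ### Typical sets and almost lossless block compression -/

section MemorylessSource

variable {Ω 𝒳 : Type*} [MeasurableSpace Ω] {μ : Measure Ω} [Fintype 𝒳]

/-- The information content, in bits, of a letter drawn according to the law of `Y`. -/
def information (μ : Measure Ω) (Y : Ω → 𝒳) (a : 𝒳) : ℝ :=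
  -Real.logb 2 (law μ Y a)

omit [Fintype 𝒳] in
lemma logb_prod_law {ι : Type*} [Fintype ι] {Y : Ω → 𝒳} {x : ι → 𝒳}
    (hx : ∀ i, law μ Y (x i) ≠ 0) :
    Real.logb 2 (∏ i, law μ Y (x i)) = -∑ i, information μ Y (x i) := by
  rw [Real.logb_prod _ _ fun i _ => hx i, ← Finset.sum_neg_distrib]
  simp [information]

variable [IsProbabilityMeasure μ]

lemma integral_information {Y : Ω → 𝒳} (hY : DiscretelyMeasurable Y) :
    ∫ ω, information μ Y (Y ω) ∂μ = entropy μ Y := by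
  rw [← sum_law_mul_eq_integral hY, entropy_eq_sum_law, ← Finset.sum_neg_distrib]
  simp [information]

/-- Letters of probability zero break the logarithm of a product into a sum; almost surely they do
not occur. -/
lemma ae_law_ne_zero {Y Z : Ω → 𝒳} (h : law μ Z = law μ Y) : ∀ᵐ ω ∂μ, law μ Y (Z ω) ≠ 0 := by
  have h1 : ∀ a : 𝒳, ∀ᵐ ω ∂μ, law μ Y a = 0 → Z ω ≠ a := by
    intro a
    by_cases ha : law μ Y a = 0
    · rw [← h] at ha
      have : μ {ω | Z ω = a} = 0 := (measureReal_eq_zero_iff).1 ha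
      filter_upwards [compl_mem_ae_iff.2 this] with ω hω _ using hω
    · simp [ha]
  filter_upwards [ae_all_iff.2 h1] with ω hω h0 using hω _ h0 rfl

/-- The blocks whose probability is at least `2 ^ (-n (H + δ))`. -/
def typicalSet (μ : Measure Ω) (Y : Ω → 𝒳) (n : ℕ) (δ : ℝ) : Set (Fin n → 𝒳) :=
  {x | (2 : ℝ) ^ (-(n * (entropy μ Y + δ))) ≤ ∏ j, law μ Y (x j)}

/-- Each member has probability at least `2 ^ (-t)`, and these probabilities sum to at most one. -/
lemma ncard_typicalSet_le {Y : Ω → 𝒳} (hY : DiscretelyMeasurable Y) (n : ℕ) (δ : ℝ) :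
    ((typicalSet μ Y n δ).ncard : ℝ) ≤ (2 : ℝ) ^ (n * (entropy μ Y + δ)) := by
  classical
  set t : ℝ := n * (entropy μ Y + δ)
  have h1 : ∑ x : Fin n → 𝒳, ∏ j, law μ Y (x j) = 1 := by
    rw [← Fintype.prod_sum fun (_ : Fin n) a => law μ Y a]
    simp [sum_law hY]
  have h2 : ((typicalSet μ Y n δ).ncard : ℝ) * (2 : ℝ) ^ (-t) ≤ 1 := by
    rw [Set.ncard_eq_toFinset_card', ← h1, ← nsmul_eq_mul, ← Finset.sum_const]
    refine (Finset.sum_le_sum fun x hx => ?_).trans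
      (Finset.sum_le_sum_of_subset_of_nonneg (Finset.subset_univ _) fun x _ _ =>
        Finset.prod_nonneg fun j _ => law_nonneg _ _)
    have hx' : x ∈ typicalSet μ Y n δ := Set.mem_toFinset.1 hx
    exact hx'
  rw [Real.rpow_neg two_pos.le, ← div_eq_mul_inv, div_le_one (by positivity)] at h2
  exact h2

variable [MeasurableSpace 𝒳] [MeasurableSingletonClass 𝒳]

lemma discretelyMeasurable_pi {ι : Type*} [Fintype ι] {Z : ι → Ω → 𝒳}
    (hZ : ∀ i, Measurable (Z i)) : DiscretelyMeasurable (fun ω i => Z i ω) := fun s =>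
  measurable_pi_lambda _ hZ (Set.toFinite s).measurableSet

omit [Fintype 𝒳] [IsProbabilityMeasure μ] in
lemma law_pi {ι : Type*} [Fintype ι] {Z : ι → Ω → 𝒳} (h : iIndepFun Z μ) (x : ι → 𝒳) :
    law μ (fun ω i => Z i ω) x = ∏ i, law μ (Z i) (x i) := by
  have h1 := h.measure_inter_preimage_eq_mul Finset.univ (sets := fun i => {x i})
    (fun i _ => measurableSet_singleton _)
  have h2 : {ω | (fun i => Z i ω) = x} = ⋂ i ∈ Finset.univ, Z i ⁻¹' {x i} := by
    ext ω; simp [funext_iff]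
  rw [law, h2, measureReal_def, h1, ENNReal.toReal_prod]
  rfl

variable {X : ℕ → Ω → 𝒳} (hX : ∀ i, Measurable (X i)) (hindep : iIndepFun X μ)
  (hident : ∀ i, IdentDistrib (X i) (X 0) μ μ)

include hident in
omit [Fintype 𝒳] [IsProbabilityMeasure μ] in
lemma law_eq_of_identDistrib (i : ℕ) : law μ (X i) = law μ (X 0) := by
  funext a
  exact congrArg ENNReal.toReal ((hident i).measure_mem_eq (measurableSet_singleton a))

include hX in
omit [IsProbabilityMeasure μ] in
lemma discretelyMeasurable_source (i : ℕ) : DiscretelyMeasurable (X i) := fun s =>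
  hX i (Set.toFinite s).measurableSet

include hX hident in
lemma integral_information_source (i : ℕ) :
    ∫ ω, information μ (X 0) (X i ω) ∂μ = entropy μ (X 0) := by
  rw [← sum_law_mul_eq_integral (discretelyMeasurable_source hX i),
    law_eq_of_identDistrib hident, sum_law_mul_eq_integral (discretelyMeasurable_source hX 0),
    integral_information (discretelyMeasurable_source hX 0)]

include hX in
lemma memLp_information_source (i : ℕ) :
    MemLp (fun ω => information μ (X 0) (X i ω)) 2 μ := by
  have hm : Measurable (fun ω => information μ (X 0) (X i ω)) :=
    (measurable_of_finite (information μ (X 0))).comp (hX i)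
  obtain ⟨C, hC⟩ := (Set.finite_range fun a => ‖information μ (X 0) a‖).bddAbove
  exact MemLp.of_bound hm.aestronglyMeasurable C
    (Eventually.of_forall fun ω => hC ⟨X i ω, rfl⟩)

include hindep hident in
omit [Fintype 𝒳] [IsProbabilityMeasure μ] in
lemma law_source_pi {ι : Type*} [Fintype ι] {e : ι → ℕ} (he : e.Injective) (x : ι → 𝒳) :
    law μ (fun ω i => X (e i) ω) x = ∏ i, law μ (X 0) (x i) := by
  refine (law_pi (Z := fun i => X (e i)) (hindep.precomp he) x).trans ?_
  simp_rw [law_eq_of_identDistrib hident]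

include hident in
lemma ae_law_source_ne_zero {ι : Type*} [Countable ι] (e : ι → ℕ) :
    ∀ᵐ ω ∂μ, ∀ i, law μ (X 0) (X (e i) ω) ≠ 0 :=
  ae_all_iff.2 fun i => ae_law_ne_zero (law_eq_of_identDistrib hident (e i))

include hX hindep hident in
lemma entropy_source_pi {ι : Type*} [Fintype ι] [DecidableEq ι] {e : ι → ℕ} (he : e.Injective) :
    entropy μ (fun ω i => X (e i) ω) = Fintype.card ι * entropy μ (X 0) := by
  rw [← integral_information (discretelyMeasurable_pi fun i => hX (e i))]
  have h : ∀ᵐ ω ∂μ, information μ (fun ω i => X (e i) ω) (fun i => X (e i) ω)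
      = ∑ i, information μ (X 0) (X (e i) ω) := by
    filter_upwards [ae_law_source_ne_zero hident e] with ω hω
    rw [information, law_source_pi hindep hident he, logb_prod_law hω, neg_neg]
  rw [integral_congr_ae h, integral_finsetSum]
  · simp [integral_information_source hX hident]
  · exact fun i _ => (memLp_information_source hX (e i)).integrable one_le_two

include hX hindep hident in
lemma entropy_sourcePrefix (N : ℕ) :
    entropy μ (sourcePrefix X N) = N * entropy μ (X 0) := by
  refine (entropy_source_pi hX hindep hident (e := fun i : Fin N => (i : ℕ))
    Fin.val_injective).trans ?_
  rw [Fintype.card_fin]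

include hX hindep hident in
-- The information of an atypical block exceeds its mean by more than `n δ`, so Chebyshev applies.
-- Allowing arbitrary positions `e` lets one typical set serve all `k` blocks.
lemma measureReal_notMem_typicalSet_le {n : ℕ} (hn : 1 ≤ n) {δ : ℝ} (hδ : 0 < δ)
    {e : Fin n → ℕ} (he : e.Injective) :
    μ.real {ω | (fun j => X (e j) ω) ∉ typicalSet μ (X 0) n δ}
      ≤ variance (fun ω => information μ (X 0) (X 0 ω)) μ / (n * δ ^ 2) := by
  have hn' : (0 : ℝ) < n := by exact_mod_cast hn
  set J : ℕ → Ω → ℝ := fun i ω => information μ (X 0) (X i ω)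
  have hJ : ∀ i, MemLp (J i) 2 μ := memLp_information_source hX
  set S : Ω → ℝ := ∑ j, J (e j)
  have hS : MemLp S 2 μ := memLp_finsetSum' _ fun j _ => hJ (e j)
  have hmean : ∫ ω, S ω ∂μ = n * entropy μ (X 0) := by
    simp only [S, Finset.sum_apply]
    rw [integral_finsetSum _ fun j _ => (hJ (e j)).integrable one_le_two]
    simp [J, integral_information_source hX hident]
  have hvar : variance S μ = n * variance (J 0) μ := by
    rw [IndepFun.variance_sum (fun j _ => hJ (e j))]
    · have : ∀ i, variance (J i) μ = variance (J 0) μ := fun i =>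
        ((hident i).comp (measurable_of_finite (information μ (X 0)))).variance_eq
      simp [this]
    · intro i _ j _ hij
      exact (hindep.indepFun (he.ne hij)).comp (measurable_of_finite (information μ (X 0)))
        (measurable_of_finite (information μ (X 0)))
  have hcheb := meas_ge_le_variance_div_sq hS (c := n * δ) (by positivity)
  have hsub : μ {ω | (fun j => X (e j) ω) ∉ typicalSet μ (X 0) n δ}
      ≤ μ {ω | n * δ ≤ |S ω - ∫ ω, S ω ∂μ|} := by
    refine measure_mono_ae ?_
    filter_upwards [ae_law_source_ne_zero hident e] with ω hω hmem
    have hpos : 0 < ∏ j, law μ (X 0) (X (e j) ω) :=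
      Finset.prod_pos fun j _ => (law_nonneg _ _).lt_of_ne (hω j).symm
    have h1 : ∏ j, law μ (X 0) (X (e j) ω) < (2 : ℝ) ^ (-(n * (entropy μ (X 0) + δ))) :=
      not_le.1 hmem
    rw [← Real.logb_lt_iff_lt_rpow one_lt_two hpos, logb_prod_law hω, neg_lt_neg_iff] at h1
    change n * δ ≤ |S ω - ∫ ω, S ω ∂μ|
    rw [hmean]
    refine le_trans ?_ (le_abs_self _)
    have h2 : S ω = ∑ j, information μ (X 0) (X (e j) ω) := by simp [S, J]
    rw [h2]
    linarith
  refine ENNReal.toReal_le_of_le_ofReal (by have := variance_nonneg (J 0) μ; positivity)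
    ((hsub.trans hcheb).trans_eq ?_)
  rw [hvar]
  congr 1
  field_simp
  rfl

include hX hindep hident in
/-- Almost lossless compression of `n` letters to `m` bits, at rate `δ` above the entropy. -/
lemma exists_block_code {n m : ℕ} (hn : 1 ≤ n) {δ : ℝ} (hδ : 0 < δ)
    (hm : n * (entropy μ (X 0) + δ) ≤ m) :
    ∃ (T : Set (Fin n → 𝒳)) (f : (Fin n → 𝒳) → Fin m → Bool), Set.InjOn f T ∧
      ∀ e : Fin n → ℕ, e.Injective → μ.real {ω | (fun j => X (e j) ω) ∉ T}
        ≤ variance (fun ω => information μ (X 0) (X 0 ω)) μ / (n * δ ^ 2) := by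
  classical
  refine ⟨typicalSet μ (X 0) n δ, ?_⟩
  have hcard : Fintype.card (typicalSet μ (X 0) n δ) ≤ Fintype.card (Fin m → Bool) := by
    have h := (ncard_typicalSet_le (discretelyMeasurable_source hX 0) n δ).trans
      (Real.rpow_le_rpow_of_exponent_le (one_le_two (α := ℝ)) hm)
    rw [Real.rpow_natCast] at h
    rw [← Nat.card_eq_fintype_card, Nat.card_coe_set_eq]
    simpa using (by exact_mod_cast h : (typicalSet μ (X 0) n δ).ncard ≤ 2 ^ m)
  obtain ⟨g⟩ := Function.Embedding.nonempty_of_card_le hcard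
  refine ⟨fun x => if hx : x ∈ typicalSet μ (X 0) n δ then g ⟨x, hx⟩ else fun _ => false,
    fun x hx y hy h => ?_, fun e he => measureReal_notMem_typicalSet_le hX hindep hident hn hδ he⟩
  simp only [dif_pos hx, dif_pos hy] at h
  simpa using g.injective h

end MemorylessSource

/-! ### Converse: Fano bounds at grid points, then right limits -/

section Converse

variable {Ω 𝒳 : Type*} {G : ℝ → ℝ} {ε : ℝ} {k n : ℕ}

lemma sum_rate_ge {i : ℕ} (hi : i ≤ k) (hk : 1 ≤ k) :
    ∑ j : {j : Fin k // i ≤ (j : ℕ)}, rate G k j = G 1 - G ((i : ℝ) / k) := by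
  have h : ∀ (g : ℕ → ℝ) (m : ℕ), i ≤ m →
      ∑ j : Fin m, (if i ≤ (j : ℕ) then g (j + 1) - g j else 0) = g m - g i := by
    intro g m hm
    induction m with
    | zero => obtain rfl : i = 0 := by omega
              simp
    | succ m ih =>
      rw [Fin.sum_univ_castSucc]
      rcases hm.eq_or_lt with rfl | hlt
      · simp only [Fin.val_castSucc, Fin.val_last]
        rw [Finset.sum_eq_zero fun j _ => if_neg (by have := j.2; omega), if_neg (by omega)]
        simp
      · simp only [Fin.val_castSucc, Fin.val_last]
        rw [ih (by omega), if_pos (by omega)]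
        ring
  have hk' : (k : ℝ) ≠ 0 := by positivity
  have := h (fun j => G ((j : ℝ) / k)) k hi
  rw [← Finset.sum_filter, div_self hk'] at this
  rw [← this, Finset.sum_subtype (p := fun j : Fin k => i ≤ (j : ℕ)) (F := inferInstance) _
    (by simp)]
  simp [rate]

lemma rate_nonneg (hG : IsRegularCumulative G) (i : Fin k) : 0 ≤ rate G k i := by
  have hk : (0 : ℝ) < k := by exact_mod_cast i.pos
  have hi : ((i : ℕ) : ℝ) + 1 ≤ k := by exact_mod_cast i.2
  refine sub_nonneg.2 (hG.monotoneOn ⟨by positivity, ?_⟩ ⟨by positivity, ?_⟩ (by gcongr; linarith))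
  · rw [div_le_one hk]; linarith
  · rw [div_le_one hk]; linarith

/-- The messages as functions of the whole source block. -/
def SourceCode.encodeAll (c : SourceCode 𝒳 G ε k n) (x : Fin (k * n) → 𝒳) (j : Fin k) :
    Fin (numMessages G ε k n j) :=
  c.enc j fun t => x (Fin.castLE (Nat.mul_le_mul_right n j.2) t)

/-- The rates telescope, floors only help, and at most `k` messages each contribute an excess `ε`.
-/
lemma logb_card_messages_ge_le (hG : IsRegularCumulative G) (hε : 0 ≤ ε) {i : ℕ} (hi : i ≤ k)
    (hk : 1 ≤ k) :
    Real.logb 2 (Fintype.card ((j : {j : Fin k // i ≤ (j : ℕ)}) → Fin (numMessages G ε k n j)))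
      ≤ n * k * (G 1 - G ((i : ℝ) / k)) + n * k * (k * ε) := by
  rw [Fintype.card_pi]
  simp_rw [Fintype.card_fin]
  simp only [numMessages, Finset.prod_pow_eq_pow_sum]
  push_cast
  rw [← Real.rpow_natCast, Real.logb_rpow two_pos (by norm_num)]
  push_cast
  refine (Finset.sum_le_sum fun j _ => Nat.floor_le
    (by have := rate_nonneg hG j.1; positivity)).trans ?_
  rw [← Finset.mul_sum, Finset.sum_add_distrib, sum_rate_ge hi hk, mul_add]
  gcongr
  rw [Finset.sum_const, nsmul_eq_mul]
  gcongr
  simpa using Fintype.card_subtype_le fun j : Fin k => i ≤ (j : ℕ)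

variable [MeasurableSpace Ω] {μ : Measure Ω} [IsProbabilityMeasure μ] [Fintype 𝒳]
  [MeasurableSpace 𝒳] [MeasurableSingletonClass 𝒳] {X : ℕ → Ω → 𝒳}
  (hX : ∀ i, Measurable (X i)) (hindep : iIndepFun X μ)
  (hident : ∀ i, IdentDistrib (X i) (X 0) μ μ)

include hX in
lemma discretelyMeasurable_sourcePrefix (N : ℕ) : DiscretelyMeasurable (sourcePrefix X N) :=
  discretelyMeasurable_pi fun i : Fin N => hX i

include hX in
lemma mutualInfo_messagesUpTo (c : SourceCode 𝒳 G ε k n) (i : Fin k) :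
    mutualInfo μ (sourcePrefix X (((i : ℕ) + 1) * n)) (c.messagesUpTo X i)
      = entropy μ (c.messagesUpTo X i) :=
  mutualInfo_comp (discretelyMeasurable_sourcePrefix hX _)
    (fun (v : Fin (((i : ℕ) + 1) * n) → 𝒳) (j : {j : Fin k // j ≤ i}) =>
      c.enc j fun t => v (Fin.castLE (Nat.mul_le_mul_right n (Nat.succ_le_succ j.2)) t))

include hX hindep hident in
/-- If `V` determines the first `i` messages, then the source entropy exceeds the entropy of `V`
by at most the number of bits in the remaining messages, up to the Fano term. -/
lemma entropy_source_le_of_determines {B : Type*} [Fintype B] (hG : IsRegularCumulative G)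
    (hε : 0 ≤ ε) (c : SourceCode 𝒳 G ε k n) {i : ℕ} (hi : i ≤ k) (hk : 1 ≤ k)
    (V : (Fin (k * n) → 𝒳) → B)
    (d : B → (j : {j : Fin k // (j : ℕ) < i}) → Fin (numMessages G ε k n j))
    (hd : ∀ x j, d (V x) j = c.encodeAll x j) :
    n * k * entropy μ (X 0) ≤ entropy μ (fun ω => V (sourcePrefix X (k * n) ω))
      + (n * k * (G 1 - G ((i : ℝ) / k)) + n * k * (k * ε))
      + (1 + μ.real {ω | sourcePrefix X (k * n) ω ≠ c.reconstruction X ω}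
          * (n * k * Real.logb 2 (Fintype.card 𝒳))) := by
  have hY := discretelyMeasurable_sourcePrefix hX (k * n)
  have h1 := entropy_le_of_decoder (μ := μ) hY c.encodeAll c.dec
  have hcard : Real.logb 2 (Fintype.card (Fin (k * n) → 𝒳))
      = n * k * Real.logb 2 (Fintype.card 𝒳) := by
    rw [Fintype.card_fun, Fintype.card_fin]
    push_cast
    rw [Real.logb_pow]
    push_cast
    ring
  rw [entropy_sourcePrefix hX hindep hident, hcard] at h1
  let later : (Fin (k * n) → 𝒳) → (j : {j : Fin k // i ≤ (j : ℕ)}) → Fin (numMessages G ε k n j) :=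
    fun x j => c.encodeAll x j
  have h2 : entropy μ (fun ω => c.encodeAll (sourcePrefix X (k * n) ω))
      ≤ entropy μ (fun ω => (V (sourcePrefix X (k * n) ω), later (sourcePrefix X (k * n) ω))) := by
    -- All messages are reassembled from `V` (the early ones) and `later`.
    let F : B × ((j : {j : Fin k // i ≤ (j : ℕ)}) → Fin (numMessages G ε k n j)) →
        (j : Fin k) → Fin (numMessages G ε k n j) := fun v j =>
      if hj : (j : ℕ) < i then d v.1 ⟨j, hj⟩ else v.2 ⟨j, not_lt.1 hj⟩
    have h := entropy_comp_le (μ := μ) (hY.comp fun x => (V x, later x)) F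
    refine le_of_eq_of_le ?_ h
    congr 1
    funext ω j
    by_cases hj : (j : ℕ) < i
    · simp only [F, dif_pos hj, hd]
    · simp only [F, dif_neg hj, later]
  have h3 := entropy_prod_le (μ := μ) hY V later
  have h4 := (entropy_le_logb_card (μ := μ) (hY.comp later)).trans
    (logb_card_messages_ge_le hG hε hi hk)
  push_cast at h1
  have h5 : {ω | sourcePrefix X (k * n) ω ≠ c.dec (c.encodeAll (sourcePrefix X (k * n) ω))}
    = {ω | sourcePrefix X (k * n) ω ≠ c.reconstruction X ω} := rfl
  rw [h5] at h1
  linarith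

/-- Dividing by `n k` with `k` fixed, the Fano term and the rate excess vanish in the limit. -/
lemma le_of_forall_large_block {a b C : ℝ} {p ε : ℕ → ℝ} (hk : 1 ≤ k)
    (hp : Tendsto p atTop (𝓝 0)) (hε : Tendsto ε atTop (𝓝 0))
    (h : ∀ n : ℕ, 1 ≤ n → n * k * a ≤ n * k * b + n * k * (k * ε n)
      + (1 + p n * (n * k * C))) : a ≤ b := by
  have h1 : Tendsto (fun n : ℕ => b + k * ε n + ((n : ℝ)⁻¹ * (k : ℝ)⁻¹ + p n * C)) atTop
      (𝓝 (b + k * 0 + (0 * (k : ℝ)⁻¹ + 0 * C))) :=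
    (tendsto_const_nhds.add (hε.const_mul _)).add
      ((tendsto_inv_atTop_nhds_zero_nat.mul_const _).add (hp.mul_const _))
  have h2 : a ≤ b + k * 0 + (0 * (k : ℝ)⁻¹ + 0 * C) := by
    refine ge_of_tendsto h1 ?_
    filter_upwards [eventually_ge_atTop 1] with n hn
    have hn' : (0 : ℝ) < n := by exact_mod_cast hn
    have hk' : (0 : ℝ) < k := by exact_mod_cast hk
    have := h n hn
    refine le_of_mul_le_mul_left (this.trans_eq ?_) (mul_pos hn' hk')
    field_simp
  simpa using h2

include hX hindep hident in
-- The leakage bound needs `1 ≤ i`, since leakage is only constrained at the ends of sub-blocks.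
lemma achievable_bounds_at_grid (hG : IsRegularCumulative G) {L : ℝ → ℝ}
    (hach : Achievable μ X G L) {i : ℕ} (hi : i ≤ k) (hk : 1 ≤ k) :
    (1 - (i : ℝ) / k) * entropy μ (X 0) ≤ G 1 - G ((i : ℝ) / k) ∧
      (1 ≤ i → entropy μ (X 0) - L ((i : ℝ) / k) ≤ G 1 - G ((i : ℝ) / k)) := by
  obtain ⟨ε, hε0, hε, c, herr, hleak⟩ := hach k hk
  have hk' : (0 : ℝ) < k := by exact_mod_cast hk
  constructor
  · suffices h : entropy μ (X 0)
        ≤ (i : ℝ) / k * entropy μ (X 0) + (G 1 - G ((i : ℝ) / k)) by linarith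
    refine le_of_forall_large_block hk herr hε (C := Real.logb 2 (Fintype.card 𝒳))
      fun n hn => ?_
    -- Here `V` is the source prefix of `i * n` letters.
    refine (entropy_source_le_of_determines hX hindep hident hG (hε0 n) (c n) hi hk
      (fun x (t : Fin (i * n)) => x (Fin.castLE (Nat.mul_le_mul_right n hi) t))
      (fun v j => (c n).enc j fun t => v (Fin.castLE (Nat.mul_le_mul_right n j.2) t))
      fun x j => rfl).trans_eq ?_
    have h : entropy μ (fun ω (t : Fin (i * n)) =>
        sourcePrefix X (k * n) ω (Fin.castLE (Nat.mul_le_mul_right n hi) t))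
        = i * n * entropy μ (X 0) :=
      (entropy_sourcePrefix hX hindep hident (i * n)).trans (by push_cast; ring)
    rw [h]
    field_simp
    ring
  · intro hi1
    suffices h : entropy μ (X 0) ≤ L ((i : ℝ) / k) + (G 1 - G ((i : ℝ) / k)) by linarith
    refine le_of_forall_large_block hk herr hε (C := Real.logb 2 (Fintype.card 𝒳))
      fun n hn => ?_
    have hn' : (0 : ℝ) < n := by exact_mod_cast hn
    obtain ⟨i, rfl⟩ : ∃ i', i = i' + 1 := ⟨i - 1, by omega⟩
    -- Here `V` consists of the first `i + 1` messages, whose entropy is the leakage at index `i :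
    -- Fin k`.
    have h1 := entropy_source_le_of_determines hX hindep hident hG (hε0 n) (c n) hi hk
      (fun x (j : {j : Fin k // j ≤ (⟨i, hi⟩ : Fin k)}) => (c n).encodeAll x j)
      (fun v j => v ⟨j.1, Nat.le_of_lt_succ j.2⟩) fun x j => rfl
    have h2 := hleak n hn ⟨i, hi⟩
    rw [mutualInfo_messagesUpTo hX, one_div, inv_mul_le_iff₀ (by positivity)] at h2
    push_cast at h1 h2 ⊢
    refine h1.trans ?_
    rw [mul_add]
    exact add_le_add_left ((add_le_add_left h2 _).trans_eq (by ring)) _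

include hX hindep hident in
lemma Achievable.cumulative_rate_bound {L : ℝ → ℝ} (hG : IsRegularCumulative G)
    (hL : IsRegularCumulative L) (hach : Achievable μ X G L) {α : ℝ} (hα : α ∈ Set.Icc (0 : ℝ) 1) :
    max ((1 - α) * entropy μ (X 0)) (entropy μ (X 0) - L α) ≤ G 1 - G α := by
  -- A rational `q` is a grid point for `k = q.den`.
  have hrat : ∀ q : ℚ, (0 : ℝ) < q → (q : ℝ) ≤ 1 →
      max ((1 - (q : ℝ)) * entropy μ (X 0)) (entropy μ (X 0) - L q) ≤ G 1 - G q := by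
    intro q hq0 hq1
    have hq0' : 0 < q.num := Rat.num_pos.2 (by exact_mod_cast hq0)
    have hq : (q : ℝ) = (q.num.toNat : ℝ) / q.den := by
      have h1 : ((q.num.toNat : ℤ) : ℝ) = (q.num : ℝ) := by rw [Int.toNat_of_nonneg hq0'.le]
      rw [Int.cast_natCast] at h1
      rw [h1]
      exact_mod_cast (Rat.num_div_den q).symm
    have hle : q.num.toNat ≤ q.den := by
      rw [hq, div_le_one (by exact_mod_cast q.pos)] at hq1
      exact_mod_cast hq1
    have h := achievable_bounds_at_grid hX hindep hident hG hach hle q.pos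
    rw [← hq] at h
    exact max_le h.1 (h.2 (by omega))
  -- The endpoint `1`, where right-continuity says nothing, is itself rational.
  rcases hα.2.eq_or_lt with rfl | hα1
  · simpa using hrat 1 (by simp) (by simp)
  have hfreq : ∃ᶠ x in 𝓝[>] α,
      max ((1 - x) * entropy μ (X 0)) (entropy μ (X 0) - L x) ≤ G 1 - G x := by
    rw [frequently_iff]
    intro U hU
    obtain ⟨u, hu, hsub⟩ := mem_nhdsGT_iff_exists_Ioo_subset.1 hU
    obtain ⟨q, hq1, hq2⟩ := exists_rat_btwn (lt_min hu hα1)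
    exact ⟨q, hsub ⟨hq1, hq2.trans_le (min_le_left _ _)⟩,
      hrat q (hα.1.trans_lt hq1) (hq2.le.trans (min_le_right _ _))⟩
  have hid : Tendsto (fun x : ℝ => x) (𝓝[>] α) (𝓝 α) := tendsto_id.mono_left nhdsWithin_le_nhds
  exact le_of_tendsto_of_tendsto_of_frequently
    (((tendsto_const_nhds.sub hid).mul_const _).max
      (tendsto_const_nhds.sub (hL.right_continuous α ⟨hα.1, hα1⟩)))
    (tendsto_const_nhds.sub (hG.right_continuous α ⟨hα.1, hα1⟩)) hfreq

end Converse

/-! ### Bit streams and their segments -/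

section BitStreams

variable {𝒳 : Type*}

/-- The message of `c` bits that carries the bits of `u` at the positions `a ≤ t < b`. -/
def segmentMessage (c : ℕ) (u : ℕ → Bool) (a b : ℕ) : Fin (2 ^ c) :=
  Fintype.equivFinOfCardEq (α := Fin c → Bool) (by simp)
    fun t => if a + t < b then u (a + t) else false

lemma segmentMessage_congr {c a b : ℕ} {u v : ℕ → Bool} (h : ∀ t, t < b → u t = v t) :
    segmentMessage c u a b = segmentMessage c v a b := by
  unfold segmentMessage
  congr 1
  funext t
  split_ifs with ht
  · exact h _ ht
  · rfl

/-- With `b ≤ a + c` the segment fits into the message, so no bit is truncated. -/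
lemma eq_of_segmentMessage_eq {c a b : ℕ} {u v : ℕ → Bool} (hb : b ≤ a + c)
    (h : segmentMessage c u a b = segmentMessage c v a b) {t : ℕ} (hat : a ≤ t) (htb : t < b) :
    u t = v t := by
  have h1 := congrFun ((Equiv.injective _) h) ⟨t - a, by omega⟩
  have h2 : a + (t - a) = t := by omega
  simpa only [h2, if_pos htb] using h1

/-- A finite word, continued by an arbitrary letter. -/
def pad (a : 𝒳) {N : ℕ} (x : Fin N → 𝒳) (s : ℕ) : 𝒳 :=
  if h : s < N then x ⟨s, h⟩ else a

/-- The `b`-th block of length `n`. -/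
def block (n : ℕ) (x : ℕ → 𝒳) (b : ℕ) (r : Fin n) : 𝒳 :=
  x (b * n + r)

/-- The concatenation of the code words of length `m` of all blocks of length `n`. -/
def codeStream {n m : ℕ} (f : (Fin n → 𝒳) → Fin m → Bool) (x : ℕ → 𝒳) (t : ℕ) : Bool :=
  -- The default is reached only for `m = 0`.
  if h : t % m < m then f (block n x (t / m)) ⟨t % m, h⟩ else false

/-- The first `i * m` bits encode only the first `i` blocks; this is what makes causal sending
possible. -/
lemma codeStream_congr {n m i : ℕ} {f : (Fin n → 𝒳) → Fin m → Bool} {x y : ℕ → 𝒳}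
    (h : ∀ s < i * n, x s = y s) {t : ℕ} (ht : t < i * m) :
    codeStream f x t = codeStream f y t := by
  have hb : block n x (t / m) = block n y (t / m) := by
    funext r
    refine h _ ?_
    have h1 : t / m + 1 ≤ i := Nat.div_lt_of_lt_mul (by rwa [mul_comm] at ht)
    calc t / m * n + r < (t / m + 1) * n := by have := r.2; rw [add_mul, one_mul]; omega
      _ ≤ i * n := Nat.mul_le_mul_right n h1
  rw [codeStream, codeStream, hb]

lemma eq_of_codeStream_eq {n m k : ℕ} {f : (Fin n → 𝒳) → Fin m → Bool} {x y : ℕ → 𝒳}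
    (h : ∀ t < k * m, codeStream f x t = codeStream f y t) {b : ℕ} (hb : b < k) :
    f (block n x b) = f (block n y b) := by
  funext s
  have hm : 0 < m := s.pos
  have h1 : b * m + s < k * m := by
    calc b * m + s < (b + 1) * m := by have := s.2; rw [add_mul, one_mul]; omega
      _ ≤ k * m := Nat.mul_le_mul_right m hb
  have h2 : (b * m + s) % m = s := by
    rw [mul_comm, Nat.mul_add_mod, Nat.mod_eq_of_lt s.2]
  have h3 : (b * m + s) / m = b := by
    rw [mul_comm, Nat.mul_add_div hm, Nat.div_eq_of_lt s.2, add_zero]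
  have h4 := h _ h1
  simpa only [codeStream, h2, h3, s.2, dite_true] using h4

lemma eq_of_block_eq {n k : ℕ} {a : 𝒳} {x y : Fin (k * n) → 𝒳}
    (h : ∀ b < k, block n (pad a x) b = block n (pad a y) b) : x = y := by
  funext s
  have hn : 0 < n := Nat.pos_of_ne_zero fun h0 => by subst h0; exact absurd s.2 (by simp)
  have h1 := congrFun (h (s / n) (Nat.div_lt_of_lt_mul (s.2.trans_eq (mul_comm k n))))
    ⟨s % n, Nat.mod_lt _ hn⟩
  have h2 : (s : ℕ) / n * n + s % n = s := Nat.div_add_mod' _ _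
  simpa only [block, pad, h2, s.2, dite_true] using h1

lemma exists_segment {B : ℕ → ℕ} {k t : ℕ} (h0 : B 0 ≤ t) (hk : t < B k) :
    ∃ i < k, B i ≤ t ∧ t < B (i + 1) := by
  induction k with
  | zero => omega
  | succ k ih =>
    rcases lt_or_ge t (B k) with h | h
    · obtain ⟨i, hi, h⟩ := ih h
      exact ⟨i, by omega, h⟩
    · exact ⟨k, by omega, h, hk⟩

end BitStreams

/-! ### The code that sends every bit as late as possible -/

section DelayedCode

variable {Ω 𝒳 : Type*} {G : ℝ → ℝ} {ε : ℝ} {k n m : ℕ}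

/-- The number of bits available in the `j`-th message. -/
def messageBits (G : ℝ → ℝ) (ε : ℝ) (k n j : ℕ) : ℕ :=
  ⌊(n : ℝ) * k * (G (((j : ℝ) + 1) / k) - G ((j : ℝ) / k) + ε)⌋₊

/-- The least number of bits, out of `k * m`, to be sent before the `i`-th message. -/
def sentBefore (G : ℝ → ℝ) (ε : ℝ) (k n m i : ℕ) : ℕ :=
  k * m - ∑ j ∈ Finset.Ico i k, messageBits G ε k n j

lemma sentBefore_last : sentBefore G ε k n m k = k * m := by
  simp [sentBefore]

/-- The bits scheduled for message `i` fit into it. -/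
lemma sentBefore_succ_le {i : ℕ} (hi : i < k) :
    sentBefore G ε k n m (i + 1) ≤ sentBefore G ε k n m i + messageBits G ε k n i := by
  rw [sentBefore, sentBefore, Finset.sum_eq_sum_Ico_succ_bot hi]
  omega

lemma sentBefore_mono : Monotone (sentBefore G ε k n m) := fun _ _ h =>
  Nat.sub_le_sub_left (Finset.sum_le_sum_of_subset (Finset.Ico_subset_Ico_left h)) _

/-- Causality: if the remaining messages can carry all remaining blocks, nothing is due before its
block has been seen. -/
lemma sentBefore_le {i : ℕ} (hi : i ≤ k)
    (h : (k - i) * m ≤ ∑ j ∈ Finset.Ico i k, messageBits G ε k n j) :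
    sentBefore G ε k n m i ≤ i * m := by
  have h1 : k * m = (k - i) * m + i * m := by rw [← add_mul, Nat.sub_add_cancel hi]
  rw [sentBefore]
  omega

/-- Every block of `n` letters is compressed to `m` bits, and each of the resulting `k * m` bits is
sent as late as possible. -/
def delayedCode (G : ℝ → ℝ) (ε : ℝ) (k : ℕ) {n m : ℕ} (a : 𝒳) (f : (Fin n → 𝒳) → Fin m → Bool)
    (dec : ((i : Fin k) → Fin (numMessages G ε k n i)) → (Fin (k * n) → 𝒳)) :
    SourceCode 𝒳 G ε k n where
  enc i x := segmentMessage (messageBits G ε k n i) (codeStream f (pad a x))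
    (sentBefore G ε k n m i) (sentBefore G ε k n m (i + 1))
  dec := dec

variable {a : 𝒳} {f : (Fin n → 𝒳) → Fin m → Bool}
  {dec : ((i : Fin k) → Fin (numMessages G ε k n i)) → (Fin (k * n) → 𝒳)}
  (hcap : ∀ i < k, (k - i) * m ≤ ∑ j ∈ Finset.Ico i k, messageBits G ε k n j)

include hcap

lemma encodeAll_delayedCode (x : Fin (k * n) → 𝒳) (i : Fin k) :
    (delayedCode G ε k a f dec).encodeAll x i
      = segmentMessage (messageBits G ε k n i) (codeStream f (pad a x))
          (sentBefore G ε k n m i) (sentBefore G ε k n m (i + 1)) := by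
  refine segmentMessage_congr fun t ht => codeStream_congr (i := i + 1) (fun s hs => ?_)
    (ht.trans_le ?_)
  · have hs' : s < k * n := hs.trans_le (Nat.mul_le_mul_right n i.2)
    simp only [pad, hs, hs', dite_true]
    rfl
  -- `hcap` stops short of `k`, where the schedule ends at exactly `k * m` bits.
  · rcases (Nat.succ_le_of_lt i.2).eq_or_lt with h | h
    · have h' : (i : ℕ) + 1 = k := h
      rw [h', sentBefore_last]
    · exact sentBefore_le h.le (hcap _ h)

lemma injOn_encodeAll_delayedCode {T : Set (Fin n → 𝒳)} (hf : Set.InjOn f T) :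
    Set.InjOn (delayedCode G ε k a f dec).encodeAll {x | ∀ b < k, block n (pad a x) b ∈ T} := by
  intro x hx y hy hxy
  refine eq_of_block_eq (a := a) fun b hb => hf (hx b hb) (hy b hb)
    (eq_of_codeStream_eq (k := k) (fun t ht => ?_) hb)
  have hk : 0 < k := by omega
  -- The schedule starts at bit `0`, so its segments cover all `k * m` bits.
  have h0 : sentBefore G ε k n m 0 ≤ t := (sentBefore_le hk.le (hcap 0 hk)).trans (by omega)
  obtain ⟨i, hi, h1, h2⟩ := exists_segment h0 (by rwa [sentBefore_last])
  have h := congrFun hxy ⟨i, hi⟩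
  rw [encodeAll_delayedCode hcap, encodeAll_delayedCode hcap] at h
  exact eq_of_segmentMessage_eq (sentBefore_succ_le hi) h h1 h2

variable [MeasurableSpace Ω] {μ : Measure Ω} [IsProbabilityMeasure μ] [Fintype 𝒳]
  [MeasurableSpace 𝒳] [MeasurableSingletonClass 𝒳] {X : ℕ → Ω → 𝒳}

/-- These messages are a function of the bits scheduled so far, each worth at most one bit of
entropy. -/
lemma entropy_messagesUpTo_delayedCode_le (hX : ∀ i, Measurable (X i)) (i : Fin k) :
    entropy μ ((delayedCode G ε k a f dec).messagesUpTo X i)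
      ≤ sentBefore G ε k n m (i + 1) := by
  set B := sentBefore G ε k n m
  have hY := discretelyMeasurable_sourcePrefix hX (k * n)
  let bits : (Fin (k * n) → 𝒳) → Fin (B (i + 1)) → Bool := fun x t => codeStream f (pad a x) t
  let F : (Fin (B (i + 1)) → Bool) →
      (j : {j : Fin k // j ≤ i}) → Fin (numMessages G ε k n j) := fun u j =>
    segmentMessage (messageBits G ε k n j) (pad false u) (B j) (B (j + 1))
  have h1 : (delayedCode G ε k a f dec).messagesUpTo X i
      = fun ω => F (bits (sourcePrefix X (k * n) ω)) := by
    funext ω j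
    refine (encodeAll_delayedCode hcap (sourcePrefix X (k * n) ω) j).trans ?_
    refine segmentMessage_congr fun t ht => ?_
    have ht' : t < B (i + 1) := ht.trans_le (sentBefore_mono (Nat.succ_le_succ j.2))
    simp only [pad, ht', dite_true, bits]
  rw [h1]
  refine (entropy_comp_le (hY.comp bits) F).trans
    ((entropy_le_logb_card (hY.comp bits)).trans_eq ?_)
  rw [Fintype.card_fun, Fintype.card_bool, Fintype.card_fin, Nat.cast_pow, Nat.cast_two,
    Real.logb_pow, Real.logb_self_eq_one one_lt_two, mul_one]

end DelayedCode

/-! ### Direct part: slack accounting and choice of parameters -/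

section Achievability

variable {Ω 𝒳 : Type*} [MeasurableSpace Ω] {μ : Measure Ω} [IsProbabilityMeasure μ] [Fintype 𝒳]
  [MeasurableSpace 𝒳] [MeasurableSingletonClass 𝒳] {X : ℕ → Ω → 𝒳} {G L : ℝ → ℝ} {k : ℕ}

lemma IsRegularCumulative.nonneg {F : ℝ → ℝ} (hF : IsRegularCumulative F) {α : ℝ}
    (hα : α ∈ Set.Icc (0 : ℝ) 1) : 0 ≤ F α := by
  rw [← hF.zero]
  exact hF.monotoneOn ⟨le_rfl, zero_le_one⟩ hα hα.1

lemma grid_mem_Icc (i : Fin k) : ((i : ℝ) + 1) / k ∈ Set.Icc (0 : ℝ) 1 := by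
  have hk : (0 : ℝ) < k := by exact_mod_cast i.pos
  refine ⟨by positivity, ?_⟩
  rw [div_le_one hk]
  exact_mod_cast i.2

omit [MeasurableSpace 𝒳] [MeasurableSingletonClass 𝒳] in
lemma entropy_nonneg (Y : Ω → 𝒳) : 0 ≤ entropy μ Y := by
  rw [entropy_eq_sum_law, ← Finset.sum_neg_distrib]
  refine Finset.sum_nonneg fun a _ => ?_
  rw [← mul_neg]
  exact mul_nonneg (law_nonneg _ _) (neg_nonneg.2
    (Real.logb_nonpos one_lt_two (law_nonneg _ _) measureReal_le_one))

lemma sum_messageBits_ge {ε : ℝ} (hε : 0 ≤ ε) {n i : ℕ} (hi : i < k) :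
    n * k * (G 1 - G ((i : ℝ) / k)) + n * k * ε - k
      ≤ ((∑ j ∈ Finset.Ico i k, messageBits G ε k n j : ℕ) : ℝ) := by
  have h : ∀ j ∈ Finset.Ico i k,
      (n * k * (G (((j + 1 : ℕ) : ℝ) / k) - G ((j : ℝ) / k)) + (n * k * ε - 1))
        ≤ (messageBits G ε k n j : ℝ) := fun j _ => by
    have := Nat.sub_one_lt_floor ((n : ℝ) * k * (G (((j : ℝ) + 1) / k) - G ((j : ℝ) / k) + ε))
    rw [messageBits]
    push_cast
    linarith
  have h1 := Finset.sum_le_sum h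
  have hk : (k : ℝ) ≠ 0 := by exact_mod_cast (by omega : k ≠ 0)
  rw [Finset.sum_add_distrib, ← Finset.mul_sum,
    Finset.sum_Ico_sub (fun j : ℕ => G ((j : ℝ) / k)) hi.le, div_self hk, Finset.sum_const,
    Nat.card_Ico, nsmul_eq_mul, Nat.cast_sub hi.le] at h1
  rw [Nat.cast_sum]
  have h2 : (1 : ℝ) ≤ k - i := by
    rw [le_sub_iff_add_le]; exact_mod_cast (by omega : 1 + i ≤ k)
  -- Only one of the `k - i` excesses is kept; it suffices later.
  have h3 : n * k * ε ≤ ((k : ℝ) - i) * (n * k * ε) := le_mul_of_one_le_left (by positivity) h2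
  have h4 : (0 : ℝ) ≤ i := i.cast_nonneg
  linarith

lemma mutualInfo_of_message_const (hX : ∀ i, Measurable (X i)) {ε : ℝ} {n : ℕ}
    (c : SourceCode 𝒳 G ε k n) (i : Fin k) (w : (j : Fin k) → Fin (numMessages G ε k n j))
    (hc : ∀ j x, c.enc j x = w j) :
    mutualInfo μ (sourcePrefix X (((i : ℕ) + 1) * n)) (c.messagesUpTo X i) ≤ 0 := by
  rw [mutualInfo_messagesUpTo hX]
  have hY : DiscretelyMeasurable (fun _ : Ω => ()) := fun s =>
    MeasurableSet.const (() ∈ s)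
  have h1 : c.messagesUpTo X i = fun ω => (fun _ (j : {j : Fin k // j ≤ i}) => w j)
      ((fun _ : Ω => ()) ω) := by
    funext ω j
    exact hc _ _
  rw [h1]
  refine (entropy_comp_le hY fun _ (j : {j : Fin k // j ≤ i}) => w j).trans ((entropy_le_logb_card hY).trans_eq ?_)
  simp

variable (hX : ∀ i, Measurable (X i)) (hindep : iIndepFun X μ)
  (hident : ∀ i, IdentDistrib (X i) (X 0) μ μ)

include hX in
-- Leakage is constrained for every `n ≥ 1`, errors only in the limit: constant messages serve the
-- block lengths that are too small.
lemma exists_code_without_leakage (hL : IsRegularCumulative L) (ε : ℝ) (n : ℕ) :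
    ∃ c : SourceCode 𝒳 G ε k n, ∀ i : Fin k,
      1 / ((n : ℝ) * k) *
          mutualInfo μ (sourcePrefix X (((i : ℕ) + 1) * n)) (c.messagesUpTo X i)
        ≤ L (((i : ℝ) + 1) / k) := by
  obtain ⟨ω⟩ : Nonempty Ω := nonempty_of_isProbabilityMeasure μ
  refine ⟨⟨fun i _ => ⟨0, by simp [numMessages]⟩, fun _ _ => X 0 ω⟩, fun i => ?_⟩
  refine le_trans ?_ (hL.nonneg (grid_mem_Icc i))
  exact mul_nonpos_of_nonneg_of_nonpos (by positivity)
    (mutualInfo_of_message_const hX _ i _ fun _ _ => rfl)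

include hX hindep hident in
-- `hcap` gives causality, `hleak` the leakage bound before the last sub-block, and `hL1` the one at
-- its end.
lemma exists_delayed_code (hL : IsRegularCumulative L) {n m : ℕ} (hn : 1 ≤ n)
    {δ ε : ℝ} (hδ : 0 < δ) (hm : n * (entropy μ (X 0) + δ) ≤ m)
    (hcap : ∀ i < k, (k - i) * m ≤ ∑ j ∈ Finset.Ico i k, messageBits G ε k n j)
    (hleak : ∀ i < k, (k * m : ℝ) ≤ ((∑ j ∈ Finset.Ico i k, messageBits G ε k n j : ℕ) : ℝ)
      + n * k * L ((i : ℝ) / k))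
    (hL1 : entropy μ (X 0) ≤ L 1) :
    ∃ c : SourceCode 𝒳 G ε k n,
      μ.real {ω | sourcePrefix X (k * n) ω ≠ c.reconstruction X ω}
        ≤ k * (variance (fun ω => information μ (X 0) (X 0 ω)) μ / (n * δ ^ 2)) ∧
      ∀ i : Fin k, 1 / ((n : ℝ) * k) *
          mutualInfo μ (sourcePrefix X (((i : ℕ) + 1) * n)) (c.messagesUpTo X i)
        ≤ L (((i : ℝ) + 1) / k) := by
  classical
  obtain ⟨ω₀⟩ : Nonempty Ω := nonempty_of_isProbabilityMeasure μ
  set a := X 0 ω₀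
  have : Nonempty (Fin (k * n) → 𝒳) := ⟨fun _ => a⟩
  obtain ⟨T, f, hf, hT⟩ := exists_block_code hX hindep hident hn hδ hm
  set good : Set (Fin (k * n) → 𝒳) := {x | ∀ b < k, block n (pad a x) b ∈ T}
  -- A dummy decoder: the encoders are needed first, to define the real decoder as their inverse on
  -- `good`.
  let c₀ : SourceCode 𝒳 G ε k n := delayedCode G ε k a f fun _ _ => a
  let c : SourceCode 𝒳 G ε k n :=
    delayedCode G ε k a f (Function.invFunOn c₀.encodeAll good)
  have hinj : Set.InjOn c₀.encodeAll good := injOn_encodeAll_delayedCode hcap hf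
  refine ⟨c, ?_, fun i => ?_⟩
  · have hsub : {ω | sourcePrefix X (k * n) ω ≠ c.reconstruction X ω}
        ⊆ ⋃ b ∈ Finset.range k, {ω | (fun r : Fin n => X (b * n + r) ω) ∉ T} := by
      intro ω hω
      by_contra hcon
      simp only [Set.mem_iUnion, not_exists, Finset.mem_range] at hcon
      refine hω ?_
      have hgood : sourcePrefix X (k * n) ω ∈ good := by
        intro b hb
        have h1 : block n (pad a (sourcePrefix X (k * n) ω)) b
            = fun r : Fin n => X (b * n + r) ω := by
          funext r
          have : b * n + r < k * n := by
            calc b * n + r < (b + 1) * n := by have := r.2; rw [add_mul, one_mul]; omega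
              _ ≤ k * n := Nat.mul_le_mul_right n hb
          simp only [block, pad, this, dite_true, sourcePrefix]
        rw [h1]
        exact not_not.1 (hcon b hb)
      exact (hinj.leftInvOn_invFunOn hgood).symm
    refine (measureReal_mono hsub (measure_ne_top _ _)).trans ((measureReal_biUnion_finset_le _ _).trans ?_)
    refine (Finset.sum_le_card_nsmul _ _ _ fun b _ => hT (fun r => b * n + r) ?_).trans_eq ?_
    · intro r s hrs
      exact Fin.ext (Nat.add_left_cancel hrs)
    · rw [Finset.card_range, nsmul_eq_mul]
  · have hk : (0 : ℝ) < k := by exact_mod_cast i.pos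
    have hn' : (0 : ℝ) < n := by exact_mod_cast hn
    rw [mutualInfo_messagesUpTo hX, one_div, inv_mul_le_iff₀ (by positivity)]
    -- At the end all `k * m` bits are out, possibly more than `n k L(1)`; the source entropy is the
    -- better bound.
    rcases (Nat.succ_le_of_lt i.2).eq_or_lt with h | h
    · have h' : ((i : ℕ) : ℝ) + 1 = k := by exact_mod_cast h
      rw [h', div_self hk.ne']
      have h1 := entropy_comp_le (μ := μ) (discretelyMeasurable_sourcePrefix hX (k * n))
        fun x (j : {j : Fin k // j ≤ i}) => c.encodeAll x j
      rw [entropy_sourcePrefix hX hindep hident] at h1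
      refine h1.trans ?_
      push_cast
      rw [mul_comm (n : ℝ)]
      gcongr
    · refine (entropy_messagesUpTo_delayedCode_le hcap hX i).trans ?_
      have h1 := hleak _ h
      have h2 : 0 ≤ n * k * L (((i : ℝ) + 1) / k) :=
        mul_nonneg (by positivity) (hL.nonneg (grid_mem_Icc i))
      rw [Nat.cast_succ] at h1
      rw [sentBefore]
      rcases le_total (∑ j ∈ Finset.Ico ((i : ℕ) + 1) k, messageBits G ε k n j) (k * m) with h3 | h3
      · rw [Nat.cast_sub h3]
        push_cast at h1 ⊢
        linarith
      · rw [Nat.sub_eq_zero_of_le h3]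
        simpa using h2

include hX hindep hident in
-- In `hslack`, `n * δ` pays for typicality; the `2` pays for rounding `m` up and for the floors in
-- the message lengths.
lemma exists_code_of_slack (hL : IsRegularCumulative L) {n : ℕ} (hn : 1 ≤ n)
    {δ ε η : ℝ} (hδ : 0 < δ) (hε : 0 ≤ ε) (hslack : n * δ + 2 ≤ n * (η + ε))
    (hbound : ∀ i < k, max ((1 - (i : ℝ) / k) * entropy μ (X 0))
      (entropy μ (X 0) - L ((i : ℝ) / k)) + η ≤ G 1 - G ((i : ℝ) / k))
    (hL1 : entropy μ (X 0) ≤ L 1) :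
    ∃ c : SourceCode 𝒳 G ε k n,
      μ.real {ω | sourcePrefix X (k * n) ω ≠ c.reconstruction X ω}
        ≤ k * (variance (fun ω => information μ (X 0) (X 0 ω)) μ / (n * δ ^ 2)) ∧
      ∀ i : Fin k, 1 / ((n : ℝ) * k) *
          mutualInfo μ (sourcePrefix X (((i : ℕ) + 1) * n)) (c.messagesUpTo X i)
        ≤ L (((i : ℝ) + 1) / k) := by
  have hH := entropy_nonneg (μ := μ) (X 0)
  set H := entropy μ (X 0)
  have hm := Nat.ceil_lt_add_one (a := (n : ℝ) * (H + δ)) (by positivity)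
  set m := ⌈(n : ℝ) * (H + δ)⌉₊
  have hkm : ∀ i < k, (0 : ℝ) < k ∧ k * (n * δ + 2) ≤ k * (n * (η + ε)) ∧
      n * k * (max ((1 - (i : ℝ) / k) * H) (H - L ((i : ℝ) / k)) + η)
        ≤ n * k * (G 1 - G ((i : ℝ) / k)) := fun i hi => by
    have hk : (0 : ℝ) < k := by exact_mod_cast (by omega : 0 < k)
    exact ⟨hk, by gcongr, by gcongr; exact hbound i hi⟩
  refine exists_delayed_code hX hindep hident hL hn hδ (m := m) (Nat.le_ceil _) (fun i hi => ?_)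
    (fun i hi => ?_) hL1
  · obtain ⟨hk, h1, h2⟩ := hkm i hi
    have h3 := sum_messageBits_ge (G := G) hε (n := n) hi
    have h4 : n * k * ((1 - (i : ℝ) / k) * H)
        ≤ n * k * max ((1 - (i : ℝ) / k) * H) (H - L ((i : ℝ) / k)) := by
      gcongr; exact le_max_left _ _
    have h5 : n * k * ((1 - (i : ℝ) / k) * H) = (k - i) * (n * H) := by field_simp
    have hi' : (0 : ℝ) ≤ k - i := sub_nonneg.2 (by exact_mod_cast hi.le)
    have h6 : ((k : ℝ) - i) * m ≤ (k - i) * (n * (H + δ) + 1) := by gcongr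
    have h7 : ((k : ℝ) - i) * (n * δ + 1) ≤ k * (n * δ + 1) := by
      gcongr
      simp
    have h8 : (((k - i) * m : ℕ) : ℝ)
        ≤ ((∑ j ∈ Finset.Ico i k, messageBits G ε k n j : ℕ) : ℝ) := by
      rw [Nat.cast_mul, Nat.cast_sub hi.le]
      linarith
    exact_mod_cast h8
  · obtain ⟨hk, h1, h2⟩ := hkm i hi
    have h3 := sum_messageBits_ge (G := G) hε (n := n) hi
    have h4 : n * k * (H - L ((i : ℝ) / k))
        ≤ n * k * max ((1 - (i : ℝ) / k) * H) (H - L ((i : ℝ) / k)) := by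
      gcongr; exact le_max_right _ _
    have h6 : (k : ℝ) * m ≤ k * (n * (H + δ) + 1) := by gcongr
    linarith

include hX hindep hident in
lemma achievable_of_bound (hL : IsRegularCumulative L)
    (hbound : ∀ α ∈ Set.Icc (0 : ℝ) 1,
      max ((1 - α) * entropy μ (X 0)) (entropy μ (X 0) - L α) ≤ G 1 - G α) :
    Achievable μ X G L := by
  intro k hk
  have hk' : (0 : ℝ) < k := by exact_mod_cast hk
  -- `δ n = n ^ (-1/4)` tends to zero while `n * δ n ^ 2 = √n` still drives the Chebyshev bound to
  -- zero.
  let δ : ℕ → ℝ := fun n => (√√n)⁻¹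
  have hδ : Tendsto δ atTop (𝓝 0) := tendsto_inv_atTop_zero.comp
    (Real.tendsto_sqrt_atTop.comp (Real.tendsto_sqrt_atTop.comp tendsto_natCast_atTop_atTop))
  -- This choice makes `hslack` an equality with `η = 0`.
  let ε : ℕ → ℝ := fun n => δ n + 2 * (n : ℝ)⁻¹
  have hε0 : ∀ n, 0 ≤ ε n := fun n => by positivity
  have hε : Tendsto ε atTop (𝓝 0) := by
    simpa using hδ.add (tendsto_inv_atTop_nhds_zero_nat.const_mul 2)
  have hL1 : entropy μ (X 0) ≤ L 1 := by
    have := (le_max_right _ _).trans (hbound 1 ⟨zero_le_one, le_rfl⟩)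
    linarith
  set V := variance (fun ω => information μ (X 0) (X 0 ω)) μ
  have hcode : ∀ n, ∃ c : SourceCode 𝒳 G (ε n) k n, 1 ≤ n →
      μ.real {ω | sourcePrefix X (k * n) ω ≠ c.reconstruction X ω} ≤ k * (V / √n) ∧
      ∀ i : Fin k, 1 / ((n : ℝ) * k) *
          mutualInfo μ (sourcePrefix X (((i : ℕ) + 1) * n)) (c.messagesUpTo X i)
        ≤ L (((i : ℝ) + 1) / k) := by
    intro n
    by_cases hn : 1 ≤ n
    · have hn' : (0 : ℝ) < n := by exact_mod_cast hn
      obtain ⟨c, h1, h2⟩ := exists_code_of_slack hX hindep hident (G := G) (k := k) hL hn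
        (δ := δ n) (ε := ε n) (η := 0) (by positivity) (hε0 n)
        (by simp only [ε]; field_simp; simp)
        (fun i hi => by
          rw [add_zero]
          exact hbound _ ⟨by positivity, by
            rw [div_le_one hk']; exact_mod_cast hi.le⟩) hL1
      have h3 : (n : ℝ) * δ n ^ 2 = √n := by
        simp only [δ]
        rw [inv_pow, Real.sq_sqrt (Real.sqrt_nonneg _)]
        exact Real.div_sqrt
      rw [h3] at h1
      exact ⟨c, fun _ => ⟨h1, h2⟩⟩
    · obtain ⟨c, -⟩ := exists_code_without_leakage (μ := μ) (G := G) (k := k) hX hL (ε n) n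
      exact ⟨c, fun h => absurd h hn⟩
  choose c hc using hcode
  refine ⟨ε, hε0, hε, c, ?_, fun n hn => (hc n hn).2⟩
  have hlim : Tendsto (fun n : ℕ => k * (V / √n)) atTop (𝓝 0) := by
    simpa using ((tendsto_const_nhds (x := V)).div_atTop
      (Real.tendsto_sqrt_atTop.comp tendsto_natCast_atTop_atTop)).const_mul (k : ℝ)
  refine tendsto_of_tendsto_of_tendsto_of_le_of_le' tendsto_const_nhds hlim
    (Eventually.of_forall fun n => measureReal_nonneg) ?_
  filter_upwards [eventually_ge_atTop 1] with n hn using (hc n hn).1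

include hX hindep hident in
lemma exactlyAchievable_of_strict_bound (hL : IsRegularCumulative L)
    (hbound : ∀ α ∈ Set.Ico (0 : ℝ) 1,
      max ((1 - α) * entropy μ (X 0)) (entropy μ (X 0) - L α) < G 1 - G α)
    (hL1 : entropy μ (X 0) ≤ L 1) : ExactlyAchievable μ X G L := by
  intro k hk
  have hk' : (0 : ℝ) < k := by exact_mod_cast hk
  -- Only finitely many grid points matter, so strictness yields a uniform margin.
  obtain ⟨η, hη, hηk⟩ : ∃ η > 0, ∀ i < k, max ((1 - (i : ℝ) / k) * entropy μ (X 0))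
      (entropy μ (X 0) - L ((i : ℝ) / k)) + η ≤ G 1 - G ((i : ℝ) / k) := by
    have h : ∀ i ∈ Finset.range k, ∀ᶠ η in 𝓝[>] (0 : ℝ),
        max ((1 - (i : ℝ) / k) * entropy μ (X 0))
          (entropy μ (X 0) - L ((i : ℝ) / k)) + η ≤ G 1 - G ((i : ℝ) / k) := by
      intro i hi
      have h1 := hbound ((i : ℝ) / k) ⟨by positivity, by
        rw [div_lt_one hk']; exact_mod_cast Finset.mem_range.1 hi⟩
      filter_upwards [Ioo_mem_nhdsGT (sub_pos.2 h1)] with η hη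
      linarith [hη.2]
    obtain ⟨η, h1, h2⟩ := (((Finset.eventually_all _).2 h).and self_mem_nhdsWithin).exists
    exact ⟨η, h2, fun i hi => h1 i (Finset.mem_range.2 hi)⟩
  set V := variance (fun ω => information μ (X 0) (X 0 ω)) μ
  -- With `δ = η / 2` and no excess, the slack condition reads `4 ≤ n * η`.
  have hcode : ∀ n, ∃ c : SourceCode 𝒳 G 0 k n, (4 / η ≤ n →
      μ.real {ω | sourcePrefix X (k * n) ω ≠ c.reconstruction X ω}
        ≤ k * (V / (n * (η / 2) ^ 2))) ∧
      ∀ i : Fin k, 1 / ((n : ℝ) * k) *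
          mutualInfo μ (sourcePrefix X (((i : ℕ) + 1) * n)) (c.messagesUpTo X i)
        ≤ L (((i : ℝ) + 1) / k) := by
    intro n
    by_cases hn : 4 / η ≤ n
    · have hn' : (0 : ℝ) < n := lt_of_lt_of_le (by positivity) hn
      rw [div_le_iff₀ hη] at hn
      obtain ⟨c, h1, h2⟩ := exists_code_of_slack hX hindep hident (G := G) (k := k) hL
        (by exact_mod_cast hn') (δ := η / 2) (ε := 0) (η := η) (by positivity) le_rfl
        (by linarith) hηk hL1
      exact ⟨c, fun _ => h1, h2⟩
    · obtain ⟨c, h⟩ := exists_code_without_leakage (μ := μ) (G := G) (k := k) hX hL 0 n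
      exact ⟨c, fun h => absurd h hn, h⟩
  choose c hc using hcode
  refine ⟨c, ?_, fun n _ => (hc n).2⟩
  have hlim : Tendsto (fun n : ℕ => k * (V / (n * (η / 2) ^ 2))) atTop (𝓝 0) := by
    simpa using ((tendsto_const_nhds (x := V)).div_atTop
      (tendsto_natCast_atTop_atTop.atTop_mul_const (by positivity))).const_mul (k : ℝ)
  refine tendsto_of_tendsto_of_tendsto_of_le_of_le' tendsto_const_nhds hlim
    (Eventually.of_forall fun n => measureReal_nonneg) ?_
  filter_upwards [tendsto_natCast_atTop_atTop.eventually_ge_atTop (4 / η)] with n hn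
    using (hc n).1 hn

end Achievability

lemma ExactlyAchievable.achievable {Ω 𝒳 : Type*} [MeasurableSpace Ω] [Fintype 𝒳] {μ : Measure Ω}
    {X : ℕ → Ω → 𝒳} {G L : ℝ → ℝ} (h : ExactlyAchievable μ X G L) : Achievable μ X G L :=
  fun k hk => ⟨fun _ => 0, fun _ => le_rfl, tendsto_const_nhds, h k hk⟩

end SeqCoding

end

theorem theorem1 {Ω 𝒳 : Type*} [MeasurableSpace Ω] (μ : Measure Ω) [IsProbabilityMeasure μ]
    [Fintype 𝒳] [MeasurableSpace 𝒳] [MeasurableSingletonClass 𝒳]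
    (X : ℕ → Ω → 𝒳) (hX : ∀ i, Measurable (X i)) (hindep : iIndepFun X μ)
    (hident : ∀ i, IdentDistrib (X i) (X 0) μ μ)
    (G L : ℝ → ℝ) (hG : SeqCoding.IsRegularCumulative G) (hL : SeqCoding.IsRegularCumulative L) :
    (SeqCoding.Achievable μ X G L ↔
      ∀ α ∈ Set.Icc (0 : ℝ) 1,
        max ((1 - α) * SeqCoding.entropy μ (X 0)) (SeqCoding.entropy μ (X 0) - L α)
          ≤ G 1 - G α) ∧
    (SeqCoding.ExactlyAchievable μ X G L →
      ∀ α ∈ Set.Icc (0 : ℝ) 1,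
        max ((1 - α) * SeqCoding.entropy μ (X 0)) (SeqCoding.entropy μ (X 0) - L α)
          ≤ G 1 - G α) ∧
    ((∀ α ∈ Set.Ico (0 : ℝ) 1,
        max ((1 - α) * SeqCoding.entropy μ (X 0)) (SeqCoding.entropy μ (X 0) - L α)
          < G 1 - G α) →
      SeqCoding.entropy μ (X 0) ≤ L 1 →
      SeqCoding.ExactlyAchievable μ X G L) := by
  refine ⟨⟨fun h α hα => h.cumulative_rate_bound hX hindep hident hG hL hα, fun h => ?_⟩,
    fun h α hα => h.achievable.cumulative_rate_bound hX hindep hident hG hL hα, fun h hL1 => ?_⟩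
  · exact SeqCoding.achievable_of_bound hX hindep hident hL h
  · exact SeqCoding.exactlyAchievable_of_strict_bound hX hindep hident hL h hL1
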